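/- Let $K$ be a field and let $f=\sum_{i=0}^{n}a_iY^i$ and $g=\sum_{i=0}^{m}b_iY^i$ be polynomials in $K[X][Y]=K[X,Y]$, with $a_0,\dots,a_n,b_0,\dots,b_m\in K[X]$ and $a_0a_nb_0b_m\neq 0$. Assume that neither $f$ nor $g$ has a nonconstant factor in $K[X]$, and that the resultant $\mathrm{Res}_Y(f,g)\in K[X]$ of $f$ and $g$ as polynomials in $Y$ is irreducible over $K$. If $$\deg a_0>\max\{\deg a_1,\dots,\deg a_n\}\quad\text{and}\quad \deg b_m\ge\max\{\deg b_0,\dots,\deg b_{m-1}\},$$ or if $$\deg a_0\ge\max\{\deg a_1,\dots,\deg a_n\}\quad\text{and}\quad \deg b_m>\max\{\deg b_0,\dots,\deg b_{m-1}\},$$ then both $f$ and $g$ are irreducible in $K[X,Y]$. (Here $\deg$ is the degree in $X$, and the zero polynomial and an empty maximum have degree $-\infty$.) -/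

import Mathlib

open scoped Polynomial Polynomial.Bivariate

/-!
Expand a bivariate polynomial in powers of `X` instead of `Y` and let `topCoeff f ∈ K[Y]` be the
coefficient of the highest power of `X`. It is multiplicative, and the degree hypotheses are
statements about it: the polynomial `topCoeff f` has nonzero constant term, `topCoeff g` has the
same `Y`-degree as `g`, and, according to which of the two inequalities is strict, `topCoeff f` is
constant or `topCoeff g` divides a power of `Y` (`TopCondition`). All of this passes to factors.

Let `p ∣ f` and `q ∣ g` have `X`-degrees `d`, `e` and `Y`-degrees `n`, `m`. Reading off the
coefficient of `X ^ (n * e + m * d)` in the Sylvester determinant gives the Sylvester determinant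
of `topCoeff p` and `topCoeff q`, which is nonzero since these two are coprime. Hence
`Res(p, q)` has `X`-degree at least `n * e + m * d`
(`TopCondition.le_natDegree_resultant`). If it is a unit and `n, m > 0`, then `d = e = 0`, so `p`
and `q` agree with their top coefficients: either `p` is constant in `Y` as well, or `Y ∣ q`. Both are
impossible, so one of `p`, `q` has `Y`-degree `0`.

If now `f = f₁ * f₂`, then `Res(f, g) = Res(f₁, g) * Res(f₂, g)` is irreducible, so one factor, say
the first, is a unit, and `f₁` has `Y`-degree `0`; since `f` has no nonconstant factor in `K[X]`,
`f₁` is a unit. The argument for `g` is the same.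
-/

open Polynomial Polynomial.Bivariate

/-! ### Coefficients of products and determinants at the top degree -/

theorem Polynomial.coeff_prod_sum_of_natDegree_le {R ι : Type*} [CommSemiring R]
    (s : Finset ι) (f : ι → R[X]) (d : ι → ℕ) (h : ∀ i ∈ s, (f i).natDegree ≤ d i) :
    (∏ i ∈ s, f i).coeff (∑ i ∈ s, d i) = ∏ i ∈ s, (f i).coeff (d i) := by
  classical
  induction s using Finset.induction_on with
  | empty => simp
  | insert a s ha ih =>
    rw [Finset.prod_insert ha, Finset.sum_insert ha, Finset.prod_insert ha,
      coeff_mul_add_eq_of_natDegree_le (h a (by simp)), ih fun i hi => h i (by simp [hi])]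
    exact (natDegree_prod_le _ _).trans
      (Finset.sum_le_sum fun i hi => h i (by simp [hi]))

theorem Matrix.coeff_det_of_col {R n : Type*} [CommRing R] [Fintype n] [DecidableEq n]
    (M : Matrix n n R[X]) (d : n → ℕ) (h : ∀ i j, (M i j).natDegree ≤ d j) :
    M.det.coeff (∑ j, d j) = (Matrix.of fun i j => (M i j).coeff (d j)).det := by
  rw [Matrix.det_apply, Matrix.det_apply, finsetSum_coeff]
  refine Finset.sum_congr rfl fun σ _ => ?_
  rw [coeff_smul, coeff_prod_sum_of_natDegree_le _ _ _ fun i _ => h _ _]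
  rfl

/-! ### The top coefficient in `X` -/

theorem Polynomial.Bivariate.coeff_coeff_swap {R : Type*} [CommSemiring R] (p : R[X][Y])
    (i j : ℕ) : ((swap p).coeff i).coeff j = (p.coeff j).coeff i := by
  induction p using Polynomial.induction_on' with
  | add p q hp hq => simp [hp, hq]
  | monomial n a =>
    rw [swap_monomial, coeff_mul_C, coeff_map, coeff_C_mul_X_pow, coeff_monomial]
    by_cases h : j = n
    · simp [h]
    · simp [h, Ne.symm h]

section

variable {K : Type*} [Field K]

/-- The coefficient in `K[Y]` of the highest power of `X` in a bivariate polynomial. -/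
noncomputable def topCoeff (p : K[X][Y]) : K[X] := (swap p).leadingCoeff

/-- The degree in `X` of a bivariate polynomial. -/
noncomputable def degX (p : K[X][Y]) : ℕ := (swap p).natDegree

theorem coeff_topCoeff (p : K[X][Y]) (i : ℕ) :
    (topCoeff p).coeff i = (p.coeff i).coeff (degX p) :=
  coeff_coeff_swap p _ _

theorem topCoeff_mul (p q : K[X][Y]) : topCoeff (p * q) = topCoeff p * topCoeff q := by
  simp [topCoeff]

theorem topCoeff_ne_zero {p : K[X][Y]} (hp : p ≠ 0) : topCoeff p ≠ 0 := by
  simpa [topCoeff] using hp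

theorem topCoeff_dvd {p q : K[X][Y]} (h : p ∣ q) : topCoeff p ∣ topCoeff q := by
  obtain ⟨r, rfl⟩ := h
  exact ⟨_, topCoeff_mul p r⟩

theorem natDegree_coeff_le_degX (p : K[X][Y]) (i : ℕ) : (p.coeff i).natDegree ≤ degX p := by
  refine natDegree_le_iff_coeff_eq_zero.2 fun N hN => ?_
  rw [← coeff_coeff_swap, coeff_eq_zero_of_natDegree_lt hN, coeff_zero]

theorem natDegree_topCoeff_le (p : K[X][Y]) : (topCoeff p).natDegree ≤ p.natDegree := by
  refine natDegree_le_iff_coeff_eq_zero.2 fun N hN => ?_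
  rw [coeff_topCoeff, coeff_eq_zero_of_natDegree_lt hN, coeff_zero]

theorem natDegree_topCoeff_of_dvd {p q : K[X][Y]} (hq : q ≠ 0) (h : p ∣ q)
    (hdeg : (topCoeff q).natDegree = q.natDegree) : (topCoeff p).natDegree = p.natDegree := by
  obtain ⟨r, rfl⟩ := h
  have hp := left_ne_zero_of_mul hq
  have hr := right_ne_zero_of_mul hq
  rw [topCoeff_mul, natDegree_mul (topCoeff_ne_zero hp) (topCoeff_ne_zero hr),
    natDegree_mul hp hr] at hdeg
  have := natDegree_topCoeff_le p
  have := natDegree_topCoeff_le r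
  omega

theorem coeff_eq_C_of_degX_eq_zero {p : K[X][Y]} (h : degX p = 0) (i : ℕ) :
    p.coeff i = C ((topCoeff p).coeff i) := by
  rw [coeff_topCoeff, h]
  exact eq_C_of_natDegree_le_zero ((natDegree_coeff_le_degX p i).trans h.le)

theorem coeff_topCoeff_ne_zero {p : K[X][Y]} (hp : p ≠ 0) {k : ℕ}
    (h : ∀ i, (p.coeff i).degree ≤ (p.coeff k).degree) : (topCoeff p).coeff k ≠ 0 := by
  intro h0
  refine topCoeff_ne_zero hp (Polynomial.ext fun i => ?_)
  rw [coeff_zero, coeff_topCoeff]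
  rw [coeff_topCoeff] at h0
  have hk : (p.coeff k).degree < degX p :=
    (degree_le_of_natDegree_le (natDegree_coeff_le_degX p k)).lt_of_ne fun e => by
      rw [← natDegree_eq_of_degree_eq_some e, ← leadingCoeff, leadingCoeff_eq_zero] at h0
      simp [h0] at e
  exact coeff_eq_zero_of_degree_lt ((h i).trans_lt hk)

theorem coeff_topCoeff_eq_zero {p : K[X][Y]} {i k : ℕ}
    (h : (p.coeff i).degree < (p.coeff k).degree) : (topCoeff p).coeff i = 0 := by
  rw [coeff_topCoeff]
  exact coeff_eq_zero_of_degree_lt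
    (h.trans_le (degree_le_of_natDegree_le (natDegree_coeff_le_degX p k)))

/-- The coefficients of `p` and `q` have degree at most `degX p` and `degX q`, so the determinant
of the Sylvester matrix has degree at most `m * degX q + n * degX p`. This is its coefficient
there. -/
theorem coeff_resultant_eq_resultant_topCoeff (p q : K[X][Y]) (m n : ℕ) :
    (resultant p q m n).coeff (m * degX q + n * degX p) =
      resultant (topCoeff p) (topCoeff q) m n := by
  let d : Fin (m + n) → ℕ := Fin.addCases (fun _ => degX q) fun _ => degX p
  have hd : ∑ j, d j = m * degX q + n * degX p := by simp [d, Fin.sum_univ_add]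
  have hM : ∀ i j, (sylvester p q m n i j).natDegree ≤ d j := by
    intro i j
    induction j using Fin.addCases with
    | left j =>
      simp only [sylvester, Matrix.of_apply, Fin.addCases_left, d]
      split_ifs <;> simp [natDegree_coeff_le_degX]
    | right j =>
      simp only [sylvester, Matrix.of_apply, Fin.addCases_right, d]
      split_ifs <;> simp [natDegree_coeff_le_degX]
  rw [resultant, resultant, ← hd, Matrix.coeff_det_of_col _ d hM]
  congr 1
  ext i j
  induction j using Fin.addCases with
  | left j =>
    simp only [sylvester, Matrix.of_apply, Fin.addCases_left, d, coeff_topCoeff]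
    split_ifs <;> simp
  | right j =>
    simp only [sylvester, Matrix.of_apply, Fin.addCases_right, d, coeff_topCoeff]
    split_ifs <;> simp

/-! ### Coprime top coefficients and the degree of the resultant -/

/-- The degree hypotheses in terms of top coefficients: the constant coefficient of `p` and the
leading coefficient of `q` have maximal degree in `X`, and strictly maximal degree for one of the
two. Strictness for `q` means that `topCoeff q` is a monomial; this is encoded by divisibility
so that it visibly passes to factors. -/
structure TopCondition (p q : K[X][Y]) : Prop where
  coeff_zero_left : p.coeff 0 ≠ 0
  coeff_zero_right : q.coeff 0 ≠ 0
  coeff_zero_top : (topCoeff p).coeff 0 ≠ 0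
  natDegree_top : (topCoeff q).natDegree = q.natDegree
  strict : (topCoeff p).natDegree = 0 ∨ ∃ k, topCoeff q ∣ X ^ k

namespace TopCondition

variable {p q p' q' : K[X][Y]}

theorem ne_zero_left (h : TopCondition p q) : p ≠ 0 := by
  rintro rfl
  exact h.coeff_zero_left (by simp)

theorem ne_zero_right (h : TopCondition p q) : q ≠ 0 := by
  rintro rfl
  exact h.coeff_zero_right (by simp)

theorem of_dvd (h : TopCondition p q) (hp : p' ∣ p) (hq : q' ∣ q) : TopCondition p' q' := by
  have coeff_ne {R : Type _} [CommRing R] {a b : R[X]} (hab : a ∣ b) (hb : b.coeff 0 ≠ 0) :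
      a.coeff 0 ≠ 0 := by
    obtain ⟨c, rfl⟩ := hab
    rw [mul_coeff_zero] at hb
    exact left_ne_zero_of_mul hb
  refine ⟨coeff_ne hp h.coeff_zero_left, coeff_ne hq h.coeff_zero_right,
    coeff_ne (topCoeff_dvd hp) h.coeff_zero_top,
    natDegree_topCoeff_of_dvd h.ne_zero_right hq h.natDegree_top, h.strict.imp ?_ ?_⟩
  · intro h0
    have := natDegree_le_of_dvd (topCoeff_dvd hp) (topCoeff_ne_zero h.ne_zero_left)
    omega
  · rintro ⟨k, hk⟩
    exact ⟨k, (topCoeff_dvd hq).trans hk⟩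

theorem isCoprime (h : TopCondition p q) : IsCoprime (topCoeff p) (topCoeff q) := by
  rcases h.strict with h0 | ⟨k, hk⟩
  · refine isCoprime_one_left.of_isCoprime_of_dvd_left (IsUnit.dvd ?_)
    rw [eq_C_of_natDegree_eq_zero h0]
    exact isUnit_C.2 h.coeff_zero_top.isUnit
  · have hX : IsCoprime (topCoeff p) X := by
      refine ((irreducible_X.coprime_iff_not_dvd).2 ?_).symm
      rw [X_dvd_iff]
      exact h.coeff_zero_top
    exact hX.pow_right.of_isCoprime_of_dvd_right hk

theorem le_natDegree_resultant (h : TopCondition p q) :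
    p.natDegree * degX q + q.natDegree * degX p ≤ (resultant p q).natDegree := by
  refine le_natDegree_of_ne_zero ?_
  rw [coeff_resultant_eq_resultant_topCoeff]
  -- `topCoeff p` may have smaller degree than `p`; this only costs powers of the nonzero
  -- leading coefficient of `topCoeff q`.
  obtain ⟨k, hk⟩ := Nat.exists_eq_add_of_le (natDegree_topCoeff_le p)
  have hq := topCoeff_ne_zero h.ne_zero_right
  rw [hk, resultant_add_left_deg _ _ _ _ _ le_rfl, ← h.natDegree_top]
  refine mul_ne_zero (mul_ne_zero (by simp) (pow_ne_zero _ ?_)) ?_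
  · rwa [coeff_natDegree, leadingCoeff_ne_zero]
  · rw [Ne, resultant_eq_zero_iff]
    exact fun h' => h'.2 h.isCoprime

theorem natDegree_eq_zero_of_isUnit_resultant (h : TopCondition p q)
    (hu : IsUnit (resultant p q)) : p.natDegree = 0 ∨ q.natDegree = 0 := by
  by_contra! hpos
  obtain ⟨hp, hq⟩ := hpos
  have hle := h.le_natDegree_resultant
  rw [natDegree_eq_zero_of_isUnit hu, Nat.le_zero, Nat.add_eq_zero_iff, mul_eq_zero,
    mul_eq_zero, or_iff_right hp, or_iff_right hq] at hle
  obtain ⟨hXq, hXp⟩ := hle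
  rcases h.strict with h0 | ⟨k, hk⟩
  · apply hp
    rw [← Nat.le_zero]
    refine natDegree_le_iff_coeff_eq_zero.2 fun N hN => ?_
    rw [coeff_eq_C_of_degX_eq_zero hXp, coeff_eq_zero_of_natDegree_lt (by omega), C_0]
  · apply h.coeff_zero_right
    rw [coeff_eq_C_of_degX_eq_zero hXq, C_eq_zero]
    -- A divisor of `X ^ k` of positive degree has zero constant term.
    obtain ⟨i, -, hi⟩ := (dvd_prime_pow prime_X k).1 hk
    have hdeg := natDegree_eq_of_degree_eq (degree_eq_degree_of_associated hi)
    rw [h.natDegree_top, natDegree_X_pow] at hdeg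
    rw [← X_dvd_iff]
    exact (dvd_pow_self X (by omega)).trans hi.symm.dvd

end TopCondition

/-! ### Irreducibility -/

/-- A factor of `f` of degree `0` in `Y` lies in `K[X]`. -/
theorem isUnit_of_dvd_of_natDegree_eq_zero {f p : K[X][Y]} (hf0 : f ≠ 0)
    (hf : ∀ d : K[X], C d ∣ f → d.natDegree = 0) (hp : p ∣ f) (h : p.natDegree = 0) :
    IsUnit p := by
  have hp0 := ne_zero_of_dvd_ne_zero hf0 hp
  rw [eq_C_of_natDegree_eq_zero h] at hp hp0 ⊢
  have hd := hf _ hp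
  rw [Ne, C_eq_zero] at hp0
  exact isUnit_C.2 (isUnit_iff_degree_eq_zero.2 ((degree_eq_iff_natDegree_eq hp0).2 hd))

theorem TopCondition.irreducible_and_irreducible {f g : K[X][Y]} (h : TopCondition f g)
    (hf : ∀ d : K[X], C d ∣ f → d.natDegree = 0) (hg : ∀ d : K[X], C d ∣ g → d.natDegree = 0)
    (hres : Irreducible (resultant f g)) : Irreducible f ∧ Irreducible g := by
  have hf0 := h.ne_zero_left
  have hg0 := h.ne_zero_right
  -- If `f` or `g` is constant in `Y`, it is a unit, and then so is the resultant.
  have hfdeg : f.natDegree ≠ 0 := by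
    intro h0
    apply hres.not_isUnit
    have hu := isUnit_of_dvd_of_natDegree_eq_zero hf0 hf dvd_rfl h0
    rw [eq_C_of_natDegree_eq_zero h0, isUnit_C] at hu
    rw [h0, resultant_zero_left_deg]
    exact hu.pow _
  have hgdeg : g.natDegree ≠ 0 := by
    intro h0
    apply hres.not_isUnit
    have hu := isUnit_of_dvd_of_natDegree_eq_zero hg0 hg dvd_rfl h0
    rw [eq_C_of_natDegree_eq_zero h0, isUnit_C] at hu
    rw [h0, resultant_zero_right_deg]
    exact hu.pow _
  have left {p : K[X][Y]} (hp : p ∣ f) (hu : IsUnit (resultant p g)) : IsUnit p :=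
    isUnit_of_dvd_of_natDegree_eq_zero hf0 hf hp
      (((h.of_dvd hp dvd_rfl).natDegree_eq_zero_of_isUnit_resultant hu).resolve_right hgdeg)
  have right {q : K[X][Y]} (hq : q ∣ g) (hu : IsUnit (resultant f q)) : IsUnit q :=
    isUnit_of_dvd_of_natDegree_eq_zero hg0 hg hq
      (((h.of_dvd dvd_rfl hq).natDegree_eq_zero_of_isUnit_resultant hu).resolve_left hfdeg)
  refine ⟨⟨fun hu => hfdeg (natDegree_eq_zero_of_isUnit hu), fun a b hab => ?_⟩,
    ⟨fun hu => hgdeg (natDegree_eq_zero_of_isUnit hu), fun a b hab => ?_⟩⟩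
  · have hmul : resultant f g = resultant a g * resultant b g := by
      rw [← resultant_mul_left _ _ _ _ le_rfl, hab, natDegree_mul]
      all_goals rintro rfl; simp [hab] at hf0
    exact (hres.isUnit_or_isUnit hmul).imp (left (hab ▸ dvd_mul_right a b))
      (left (hab ▸ dvd_mul_left b a))
  · have hmul : resultant f g = resultant f a * resultant f b := by
      rw [← resultant_mul_right _ _ _ _ le_rfl, hab, natDegree_mul]
      all_goals rintro rfl; simp [hab] at hg0
    exact (hres.isUnit_or_isUnit hmul).imp (right (hab ▸ dvd_mul_right a b))
      (right (hab ▸ dvd_mul_left b a))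

theorem dvd_X_pow_of_coeff_eq_zero {P : K[X]} (hP : P ≠ 0)
    (h : ∀ i < P.natDegree, P.coeff i = 0) : P ∣ X ^ P.natDegree := by
  have hmon : P = C P.leadingCoeff * X ^ P.natDegree := by
    ext i
    rw [coeff_C_mul_X_pow]
    split_ifs with hi
    · rw [hi, coeff_natDegree]
    · rcases lt_or_gt_of_ne hi with hi | hi
      · exact h i hi
      · exact coeff_eq_zero_of_natDegree_lt hi
  have hu : IsUnit (C P.leadingCoeff) := isUnit_C.2 (leadingCoeff_ne_zero.2 hP).isUnit
  conv_lhs => rw [hmon]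
  exact hu.mul_left_dvd.2 dvd_rfl

theorem TopCondition.of_degree {f g : K[X][Y]} (hf0 : f.coeff 0 ≠ 0) (hg0 : g.coeff 0 ≠ 0)
    (hf : (Finset.Icc 1 f.natDegree).sup (fun i => (f.coeff i).degree) ≤ (f.coeff 0).degree)
    (hg : (Finset.range g.natDegree).sup (fun i => (g.coeff i).degree) ≤
      (g.coeff g.natDegree).degree)
    (hs : (Finset.Icc 1 f.natDegree).sup (fun i => (f.coeff i).degree) < (f.coeff 0).degree ∨
      (Finset.range g.natDegree).sup (fun i => (g.coeff i).degree) <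
        (g.coeff g.natDegree).degree) : TopCondition f g := by
  have hfz : f ≠ 0 := by rintro rfl; simp at hf0
  have hgz : g ≠ 0 := by rintro rfl; simp at hg0
  have hgtop : (topCoeff g).coeff g.natDegree ≠ 0 := by
    refine coeff_topCoeff_ne_zero hgz fun i => ?_
    rcases lt_trichotomy i g.natDegree with hi | rfl | hi
    · exact (Finset.sup_le_iff.1 hg) i (Finset.mem_range.2 hi)
    · exact le_rfl
    · simp [coeff_eq_zero_of_natDegree_lt hi]
  have hgdeg : (topCoeff g).natDegree = g.natDegree :=
    le_antisymm (natDegree_topCoeff_le g) (le_natDegree_of_ne_zero hgtop)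
  refine ⟨hf0, hg0, ?_, hgdeg, hs.imp (fun hs => ?_) fun hs => ?_⟩
  · refine coeff_topCoeff_ne_zero hfz fun i => ?_
    rcases Nat.eq_zero_or_pos i with rfl | hi
    · exact le_rfl
    · rcases le_or_gt i f.natDegree with hi' | hi'
      · exact (Finset.sup_le_iff.1 hf) i (Finset.mem_Icc.2 ⟨hi, hi'⟩)
      · simp [coeff_eq_zero_of_natDegree_lt hi']
  · rw [← Nat.le_zero]
    refine natDegree_le_iff_coeff_eq_zero.2 fun i hi => ?_
    rcases le_or_gt i f.natDegree with hi' | hi'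
    · refine coeff_topCoeff_eq_zero (k := 0) (lt_of_le_of_lt ?_ hs)
      exact Finset.le_sup (f := fun i => (f.coeff i).degree) (Finset.mem_Icc.2 ⟨hi, hi'⟩)
    · rw [coeff_topCoeff, coeff_eq_zero_of_natDegree_lt hi', coeff_zero]
  · refine ⟨_, dvd_X_pow_of_coeff_eq_zero (topCoeff_ne_zero hgz) fun i hi => ?_⟩
    rw [hgdeg] at hi
    refine coeff_topCoeff_eq_zero (k := g.natDegree) (lt_of_le_of_lt ?_ hs)
    exact Finset.le_sup (f := fun i => (g.coeff i).degree) (Finset.mem_range.2 hi)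

end

theorem corollary6p3 {K : Type*} [Field K] (f g : K[X][Y])
    (hf0 : f.coeff 0 ≠ 0) (hg0 : g.coeff 0 ≠ 0)
    (hf : ∀ d : K[X], Polynomial.C d ∣ f → d.natDegree = 0)
    (hg : ∀ d : K[X], Polynomial.C d ∣ g → d.natDegree = 0)
    (hres : Irreducible (Polynomial.resultant f g))
    (hdeg :
      ((Finset.Icc 1 f.natDegree).sup (fun i => (f.coeff i).degree) < (f.coeff 0).degree ∧
        (Finset.range g.natDegree).sup (fun i => (g.coeff i).degree) ≤
          (g.coeff g.natDegree).degree) ∨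
      ((Finset.Icc 1 f.natDegree).sup (fun i => (f.coeff i).degree) ≤ (f.coeff 0).degree ∧
        (Finset.range g.natDegree).sup (fun i => (g.coeff i).degree) <
          (g.coeff g.natDegree).degree)) :
    Irreducible f ∧ Irreducible g := by
  have htop : TopCondition f g := by
    rcases hdeg with ⟨h1, h2⟩ | ⟨h1, h2⟩
    · exact .of_degree hf0 hg0 h1.le h2 (.inl h1)
    · exact .of_degree hf0 hg0 h1 h2.le (.inr h2)
  exact htop.irreducible_and_irreducible hf hg hres
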